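/- Let $k$ be an algebraically closed field of characteristic zero and $G$ a finite group. Let $\mathcal Z(G)$ be the braided monoidal category of finite-dimensional $G$-graded $k$-vector spaces $X=\bigoplus_{g\in G}X_g$ with a linear $G$-action such that $f(X_g)=X_{fgf^{-1}}$; morphisms preserve grading and action, the tensor product is the graded one with diagonal action, the unit object is $k$ in degree $e$ with trivial action, and the braiding is $x\otimes y\mapsto f(y)\otimes x$ for $x\in X_f$, $y\in Y$. Thus an algebra $A$ in $\mathcal Z(G)$ is an associative unital $G$-graded algebra on which $G$ acts by algebra automorphisms with $f(A_g)=A_{fgf^{-1}}$, and it is commutative if $ab=f(b)a$ for all $a\in A_f$, $b\in A$. It is called separable if there is a morphism $\epsilon:A\to 1$ in $\mathcal Z(G)$ such that the pairing $e=\epsilon\mu:A\otimes A\to 1$ ($\mu$ the multiplication) is non-degenerate, i.e. there is a morphism $\kappa:1\to A\otimes A$ such that $(e\otimes \mathrm{id})(\mathrm{id}\otimes\kappa)=\mathrm{id}_A$. It is called simple if $A\neq 0$ and its only two-sided ideals in $\mathcal Z(G)$ (graded, $G$-stable two-sided ideals) are $0$ and $A$. For a subgroup $H\subset G$ and an algebra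 $B$ in $\mathcal Z(H)$, the transfer of $B$ is the algebra $k(G)\otimes_H B$ in $\mathcal Z(G)$ spanned by symbols $p_g\otimes u$ ($g\in G$, $u\in B$), linear in $u$, with $p_{gh}\otimes u=p_g\otimes h(u)$ for $h\in H$, with grading $|p_g\otimes u|=g|u|g^{-1}$ for homogeneous $u$, action $f(p_g\otimes u)=p_{fg}\otimes u$, and multiplication $(p_g\otimes u)(p_g\otimes v)=p_g\otimes uv$ and $(p_g\otimes u)(p_{g'}\otimes v)=0$ if $gH\neq g'H$. Equivalently, it is the algebra of maps $a:G\to B$ with $a(gh)=h^{-1}(a(g))$ for $h\in H$, under pointwise operations. Let $A$ be a simple separable commutative algebra in $\mathcal Z(G)$. Then the degree-$e$ part $A_e$ has a minimal idempotent. Moreover, for every minimal idempotent $p$ of $A_e$, with stabiliser $H=\{g\in G: g(p)=p\}$: (i) there is an isomorphism of algebras from $A_e$ to the algebra $k(G/H)$ of functions on $G/H$ that is $G$-equivariant (where $(g\phi)(x)=\phi(g^{-1}x)$) and maps $p$ to the indicator function of the coset $H$; (ii) there is a simple separable commutative algebra $B$ in $\mathcal Z(H)$ with $B_e=k\cdot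 1$ such that $A$ is isomorphic, as an algebra in $\mathcal Z(G)$, to the transfer of $B$. -/

import Mathlib

open scoped TensorProduct

universe u v w w'

/-- An algebra in the braided category `Z(G)`, whose objects are finite-dimensional `G`-graded
vector spaces `X = ⊕ X_g` with a `G`-action such that `f(X_g) = X_{f g f⁻¹}`, with the tensor
product of graded vector spaces, the diagonal action, and the unit object `k` in degree `1` with
the trivial action. The multiplication and the unit are morphisms of `Z(G)`: they respect both the
grading and the action. -/
structure ZAlgebra (k : Type u) [Field k] (G : Type v) [Group G] where
  /-- the underlying vector space -/
  carrier : Type w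
  [ring : Ring carrier]
  [algebra : Algebra k carrier]
  [finite : Module.Finite k carrier]
  [action : MulSemiringAction G carrier]
  [smulComm : SMulCommClass G k carrier]
  /-- the graded components -/
  grade : G → Submodule k carrier
  grade_indep : iSupIndep grade
  grade_iSup : ⨆ g, grade g = ⊤
  smul_mem : ∀ (f g : G) (a : carrier), a ∈ grade g → f • a ∈ grade (f * g * f⁻¹)
  one_mem : (1 : carrier) ∈ grade 1
  mul_mem : ∀ (f g : G) (a b : carrier), a ∈ grade f → b ∈ grade g → a * b ∈ grade (f * g)

namespace ZAlgebra

instance {k : Type u} [Field k] {G : Type v} [Group G] :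
    CoeSort (ZAlgebra.{u, v, w} k G) (Type w) := ⟨ZAlgebra.carrier⟩

attribute [instance] ZAlgebra.ring ZAlgebra.algebra ZAlgebra.finite ZAlgebra.action
  ZAlgebra.smulComm

section Basic

variable {k : Type u} [Field k] {G : Type v} [Group G] (A : ZAlgebra.{u, v, w} k G)

/-- Commutativity with respect to the braiding `c (x ⊗ y) = f(y) ⊗ x` for `x` of degree `f`. -/
def IsCommutative : Prop :=
  ∀ (f : G) (a b : A), a ∈ A.grade f → a * b = (f • b) * a

/-- The action of a group element as a linear map. -/
def act (g : G) : A →ₗ[k] A := DistribSMul.toLinearMap k A g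

/-- The component of degree `f` of `A ⊗ A`, i.e. the sum of the `A_g ⊗ A_{g⁻¹ f}`. -/
def tensorGrade (f : G) : Submodule k (A ⊗[k] A) :=
  ⨆ g : G, LinearMap.range
    (TensorProduct.map (A.grade g).subtype (A.grade (g⁻¹ * f)).subtype)

/-- The linear map `ε` is a morphism from `A` to the unit object in `Z(G)`. -/
def IsMorphismToUnit (ε : A →ₗ[k] k) : Prop :=
  (∀ g : G, g ≠ 1 → ∀ a ∈ A.grade g, ε a = 0) ∧ ∀ (g : G) (a : A), ε (g • a) = ε a

/-- The linear map `k → A ⊗ A`, `1 ↦ κ`, is a morphism from the unit object to `A ⊗ A`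
in `Z(G)`. -/
def IsMorphismFromUnit (κ : A ⊗[k] A) : Prop :=
  κ ∈ A.tensorGrade 1 ∧ ∀ g : G, TensorProduct.map (A.act g) (A.act g) κ = κ

/-- Separability: there is a morphism `ε : A → 1` for which the pairing
`e = ε ∘ μ : A ⊗ A → 1` is non-degenerate, i.e. there is a morphism `κ : 1 → A ⊗ A` such that
`(e ⊗ id) ∘ (id ⊗ κ)` is the identity of `A`. -/
def IsSeparable : Prop :=
  ∃ (ε : A →ₗ[k] k) (κ : A ⊗[k] A), A.IsMorphismToUnit ε ∧ A.IsMorphismFromUnit κ ∧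
    ∀ a : A, TensorProduct.lid k A (LinearMap.rTensor A (ε ∘ₗ LinearMap.mulLeft k a) κ) = a

/-- A two-sided ideal of `A` in `Z(G)`: a graded, `G`-stable subspace that absorbs
multiplication on both sides. -/
structure IsIdeal (I : Submodule k A) : Prop where
  homogeneous : I ≤ ⨆ g : G, I ⊓ A.grade g
  smul_mem : ∀ (g : G) (a : A), a ∈ I → g • a ∈ I
  mul_mem_left : ∀ a b : A, b ∈ I → a * b ∈ I
  mul_mem_right : ∀ a b : A, a ∈ I → a * b ∈ I

/-- Simplicity: `A ≠ 0`, and `A` has no ideals in `Z(G)` besides `0` and `A`. -/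
def IsSimple : Prop :=
  Nontrivial A ∧ ∀ I : Submodule k A, A.IsIdeal I → I = ⊥ ∨ I = ⊤

/-- The subalgebra `A_e` of elements whose degree is the identity of `G`. -/
def unitPart : Subalgebra k A where
  carrier := A.grade 1
  mul_mem' {a b} ha hb := by simpa using A.mul_mem 1 1 a b ha hb
  one_mem' := A.one_mem
  add_mem' ha hb := (A.grade 1).add_mem ha hb
  zero_mem' := (A.grade 1).zero_mem
  algebraMap_mem' r := by
    rw [Algebra.algebraMap_eq_smul_one]
    exact (A.grade 1).smul_mem r A.one_mem

/-- A minimal idempotent of an algebra. -/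
def IsMinimalIdempotent {R : Type*} [Ring R] (p : R) : Prop :=
  IsIdempotentElem p ∧ p ≠ 0 ∧
    ∀ q : R, IsIdempotentElem q → q * p = q → p * q = q → q = 0 ∨ q = p

/-- An isomorphism of algebras in `Z(G)`. -/
structure Iso (A : ZAlgebra.{u, v, w} k G) (B : ZAlgebra.{u, v, w'} k G) where
  toAlgEquiv : A ≃ₐ[k] B
  map_smul : ∀ (g : G) (a : A), toAlgEquiv (g • a) = g • toAlgEquiv a
  map_grade : ∀ (g : G) (a : A), toAlgEquiv a ∈ B.grade g ↔ a ∈ A.grade g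

end Basic

section Transfer

variable {k : Type u} [Field k] {G : Type v} [Group G] {H : Subgroup G}
  (B : ZAlgebra.{u, v, w} k H)

/-- The underlying algebra of the transfer of `B`: the maps `a : G → B` such that
`a (g h) = h⁻¹ (a g)` for `h ∈ H`, with pointwise operations.

This is the space `k(G) ⊗_H B`, spanned by symbols `p_g ⊗ u` with `g ∈ G`, `u ∈ B` subject to
`p_{gh} ⊗ u = p_g ⊗ h(u)`: the symbol `p_g ⊗ u` is the map `spike g u` below, which is
supported on `g H` and has the value `u` at `g`. -/
def transferSubalgebra : Subalgebra k (G → B) where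
  carrier := {a | ∀ (g : G) (h : H), a (g * h) = h⁻¹ • a g}
  mul_mem' {a b} ha hb g h := by simp [ha g h, hb g h]
  one_mem' g h := by simp
  add_mem' {a b} ha hb g h := by simp [ha g h, hb g h]
  zero_mem' g h := by simp
  algebraMap_mem' r g h := by
    simp only [Pi.algebraMap_apply, Algebra.algebraMap_eq_smul_one]
    rw [smul_comm, smul_one]

/-- The action of `G` by left translation: `f (p_g ⊗ u) = p_{f g} ⊗ u`. -/
instance transferAction : MulSemiringAction G (transferSubalgebra B) where
  smul f a := ⟨fun x => a.1 (f⁻¹ * x), fun g h => by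
    change a.1 (f⁻¹ * (g * h)) = h⁻¹ • a.1 (f⁻¹ * g)
    rw [← mul_assoc]
    exact a.2 _ h⟩
  one_smul a := Subtype.ext (funext fun x => by
    change a.1 (1⁻¹ * x) = a.1 x
    simp)
  mul_smul f g a := Subtype.ext (funext fun x => by
    change a.1 ((f * g)⁻¹ * x) = a.1 (g⁻¹ * (f⁻¹ * x))
    simp [mul_assoc])
  smul_zero _ := rfl
  smul_add _ _ _ := rfl
  smul_one _ := rfl
  smul_mul _ _ _ := rfl

theorem transfer_smul_apply (f : G) (a : transferSubalgebra B) (x : G) :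
    (f • a).1 x = a.1 (f⁻¹ * x) := rfl

instance : SMulCommClass G k (transferSubalgebra B) := ⟨fun _ _ _ => rfl⟩

/-- The `H`-grading of `B` seen as a `G`-grading: `B_y = 0` for `y ∉ H`. -/
def extGrade (y : G) : Submodule k B := ⨆ hy : y ∈ H, B.grade ⟨y, hy⟩

theorem extGrade_coe (h : H) : B.extGrade (h : G) = B.grade h := by
  simp [extGrade]

theorem extGrade_of_notMem {y : G} (hy : y ∉ H) : B.extGrade y = ⊥ := by
  simp [extGrade, hy]

theorem extGrade_indep : iSupIndep B.extGrade := by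
  intro y
  by_cases hy : y ∈ H
  · have h1 := B.grade_indep ⟨y, hy⟩
    have h2 : B.extGrade y = B.grade ⟨y, hy⟩ := B.extGrade_coe ⟨y, hy⟩
    rw [h2]
    refine h1.mono_right ?_
    refine iSup₂_le fun z hz => iSup_le fun hzH => ?_
    exact le_iSup₂_of_le (⟨z, hzH⟩ : H) (fun h => hz (congrArg Subtype.val h)) le_rfl
  · rw [B.extGrade_of_notMem hy]
    exact disjoint_bot_left

/-- The grading of the transfer: `p_g ⊗ u` has degree `g |u| g⁻¹`, so `a` has degree `f` iff
`a x` has degree `x⁻¹ f x` for all `x`. -/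
def transferGrade (f : G) : Submodule k (transferSubalgebra B) where
  carrier := {a | ∀ x : G, a.1 x ∈ B.extGrade (x⁻¹ * f * x)}
  add_mem' ha hb x := Submodule.add_mem _ (ha x) (hb x)
  zero_mem' _ := Submodule.zero_mem _
  smul_mem' c _ ha x := Submodule.smul_mem _ c (ha x)

/-- Evaluation of an element of the transfer at `x`. -/
def transferEval (x : G) : transferSubalgebra B →ₗ[k] B where
  toFun a := a.1 x
  map_add' _ _ := rfl
  map_smul' _ _ := rfl

open Classical in
/-- The element `p_g ⊗ u` of the transfer. -/
noncomputable def spike (g : G) (u : B) : transferSubalgebra B :=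
  ⟨fun x => if hx : g⁻¹ * x ∈ H then (⟨g⁻¹ * x, hx⟩ : H)⁻¹ • u else 0, by
    intro x h
    beta_reduce
    by_cases hx : g⁻¹ * x ∈ H
    · have hxh : g⁻¹ * (x * h) ∈ H := by
        rw [← mul_assoc]; exact H.mul_mem hx h.2
      rw [dif_pos hx, dif_pos hxh, ← mul_smul, ← mul_inv_rev]
      congr 2
      exact Subtype.ext (mul_assoc _ _ _).symm
    · have hxh : g⁻¹ * (x * h) ∉ H := by
        rw [← mul_assoc]; exact fun hc => hx ((H.mul_mem_cancel_right h.2).1 hc)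
      rw [dif_neg hx, dif_neg hxh, smul_zero]⟩

theorem spike_apply_mul (g : G) (u : B) (h : H) : (B.spike g u).1 (g * h) = h⁻¹ • u := by
  have : g⁻¹ * (g * h) ∈ H := by simp
  simp only [spike, dif_pos this]
  congr 2
  exact Subtype.ext (by simp)

theorem spike_apply_of_notMem {g x : G} (u : B) (hx : g⁻¹ * x ∉ H) :
    (B.spike g u).1 x = 0 := by
  simp only [spike, dif_neg hx]

/-- `p_{gh} ⊗ u = p_g ⊗ h(u)`. -/
theorem spike_mul_right (g : G) (h : H) (u : B) : B.spike (g * h) u = B.spike g (h • u) := by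
  refine Subtype.ext (funext fun x => ?_)
  by_cases hx : g⁻¹ * x ∈ H
  · obtain ⟨h', rfl⟩ : ∃ h' : H, x = g * h' := ⟨⟨_, hx⟩, by simp⟩
    have e : g * (h' : G) = g * h * ((h⁻¹ * h' : H) : G) := by simp [mul_assoc]
    rw [spike_apply_mul, e, spike_apply_mul, ← mul_smul]
    simp
  · rw [spike_apply_of_notMem _ _ hx, spike_apply_of_notMem]
    rw [mul_inv_rev, mul_assoc]
    exact fun hc => hx ((H.mul_mem_cancel_left (H.inv_mem h.2)).1 hc)

/-- `(p_g ⊗ u) (p_g ⊗ v) = p_g ⊗ u v`. -/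
theorem spike_mul_spike (g : G) (u v : B) : B.spike g u * B.spike g v = B.spike g (u * v) := by
  refine Subtype.ext (funext fun x => ?_)
  change (B.spike g u).1 x * (B.spike g v).1 x = _
  by_cases hx : g⁻¹ * x ∈ H
  · obtain ⟨h', rfl⟩ : ∃ h' : H, x = g * h' := ⟨⟨_, hx⟩, by simp⟩
    simp only [spike_apply_mul, smul_mul']
  · simp only [spike_apply_of_notMem _ _ hx, mul_zero]

/-- `(p_g ⊗ u) (p_{g'} ⊗ v) = 0` when `g` and `g'` are in different cosets of `H`. -/
theorem spike_mul_spike_of_notMem {g g' : G} (hg : g⁻¹ * g' ∉ H) (u v : B) :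
    B.spike g u * B.spike g' v = 0 := by
  refine Subtype.ext (funext fun x => ?_)
  change (B.spike g u).1 x * (B.spike g' v).1 x = 0
  by_cases hx : g⁻¹ * x ∈ H
  · have hx' : g'⁻¹ * x ∉ H := fun hc => hg (by
      have := H.mul_mem hx (H.inv_mem hc)
      simpa [mul_assoc] using this)
    rw [spike_apply_of_notMem _ _ hx', mul_zero]
  · rw [spike_apply_of_notMem _ _ hx, zero_mul]

/-- `f (p_g ⊗ u) = p_{f g} ⊗ u`. -/
theorem smul_spike (f g : G) (u : B) : f • B.spike g u = B.spike (f * g) u := by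
  refine Subtype.ext (funext fun x => ?_)
  rw [transfer_smul_apply]
  by_cases hx : g⁻¹ * (f⁻¹ * x) ∈ H
  · obtain ⟨h', hh⟩ : ∃ h' : H, f⁻¹ * x = g * h' := ⟨⟨_, hx⟩, by simp⟩
    obtain rfl : x = f * g * h' := by rw [mul_assoc, ← hh, mul_inv_cancel_left]
    rw [hh, spike_apply_mul, spike_apply_mul]
  · rw [spike_apply_of_notMem _ _ hx, spike_apply_of_notMem]
    rwa [mul_inv_rev, mul_assoc]

/-- `p_g ⊗ u` has degree `g |u| g⁻¹`. -/
theorem spike_mem_grade (g : G) (h : H) (u : B) (hu : u ∈ B.grade h) :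
    B.spike g u ∈ B.transferGrade (g * h * g⁻¹) := by
  intro x
  by_cases hx : g⁻¹ * x ∈ H
  · obtain ⟨h', rfl⟩ : ∃ h' : H, x = g * h' := ⟨⟨_, hx⟩, by simp⟩
    have e : (g * h')⁻¹ * (g * h * g⁻¹) * (g * h') = ((h'⁻¹ * h * h' : H) : G) := by
      simp [mul_assoc]
    rw [spike_apply_mul, e, extGrade_coe]
    simpa using B.smul_mem h'⁻¹ h u hu
  · rw [spike_apply_of_notMem _ _ hx]
    exact Submodule.zero_mem _

theorem spike_add (g : G) (u v : B) : B.spike g (u + v) = B.spike g u + B.spike g v := by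
  refine Subtype.ext (funext fun x => ?_)
  change _ = (B.spike g u).1 x + (B.spike g v).1 x
  by_cases hx : g⁻¹ * x ∈ H
  · obtain ⟨h', rfl⟩ : ∃ h' : H, x = g * h' := ⟨⟨_, hx⟩, by simp⟩
    simp only [spike_apply_mul, smul_add]
  · simp only [spike_apply_of_notMem _ _ hx, add_zero]

theorem spike_zero (g : G) : B.spike g 0 = 0 := by
  have := B.spike_add g 0 0
  rwa [add_zero, left_eq_add] at this

theorem spike_mem_iSup (g : G) (u : B) : B.spike g u ∈ ⨆ f, B.transferGrade f := by
  have hu : u ∈ ⨆ h, B.grade h := by rw [B.grade_iSup]; trivial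
  refine Submodule.iSup_induction _ (motive := fun u => B.spike g u ∈ ⨆ f, B.transferGrade f)
    hu (fun h v hv => ?_) ?_ (fun v w hv hw => ?_)
  · exact Submodule.mem_iSup_of_mem _ (B.spike_mem_grade g h v hv)
  · rw [spike_zero]; exact Submodule.zero_mem _
  · rw [spike_add]; exact Submodule.add_mem _ hv hw

/-- The elements `p_g ⊗ u` span the transfer, with one `g` for each coset of `H`. -/
theorem eq_sum_spike [Fintype (G ⧸ H)] (a : transferSubalgebra B) :
    a = ∑ c : G ⧸ H, B.spike c.out (a.1 c.out) := by
  classical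
  refine Subtype.ext (funext fun x => ?_)
  change B.transferEval x a = B.transferEval x _
  rw [map_sum, Finset.sum_eq_single (x : G ⧸ H)]
  · obtain ⟨h, hh⟩ : ∃ h : H, x = (x : G ⧸ H).out * h :=
      ⟨⟨(x : G ⧸ H).out⁻¹ * x, QuotientGroup.eq.1 (QuotientGroup.out_eq' _)⟩, by simp⟩
    have h1 := a.2 (x : G ⧸ H).out h
    have h2 := B.spike_apply_mul (x : G ⧸ H).out (a.1 (x : G ⧸ H).out) h
    rw [← hh] at h1 h2
    exact h1.trans h2.symm
  · intro c _ hc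
    refine B.spike_apply_of_notMem _ fun hm => hc ?_
    rw [← QuotientGroup.eq.2 hm, QuotientGroup.out_eq']
  · intro h; exact absurd (Finset.mem_univ _) h

theorem transferGrade_indep : iSupIndep B.transferGrade := by
  intro f
  rw [Submodule.disjoint_def]
  intro a ha hb
  refine Subtype.ext (funext fun x => ?_)
  refine Submodule.disjoint_def.1 (B.extGrade_indep (x⁻¹ * f * x)) _ (ha x) ?_
  have hle : (⨆ g, ⨆ (_ : g ≠ f), B.transferGrade g) ≤
      (⨆ y, ⨆ (_ : y ≠ x⁻¹ * f * x), B.extGrade y).comap (B.transferEval x) := by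
    refine iSup₂_le fun g hg b hb => ?_
    refine Submodule.mem_iSup_of_mem (x⁻¹ * g * x) (Submodule.mem_iSup_of_mem ?_ (hb x))
    exact fun h => hg (mul_left_cancel (mul_right_cancel h))
  exact hle hb

/-- The transfer of an algebra `B` in `Z(H)` to an algebra in `Z(G)`. -/
def transfer [Finite G] : ZAlgebra.{u, v, max v w} k G where
  carrier := transferSubalgebra B
  finite := inferInstanceAs (Module.Finite k (Subalgebra.toSubmodule (transferSubalgebra B)))
  grade := B.transferGrade
  grade_indep := B.transferGrade_indep
  grade_iSup := by
    have := Fintype.ofFinite (G ⧸ H)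
    refine eq_top_iff.2 fun a _ => ?_
    rw [B.eq_sum_spike a]
    exact Submodule.sum_mem _ fun c _ => B.spike_mem_iSup _ _
  smul_mem f g a ha x := by
    have h := ha (f⁻¹ * x)
    have e : (f⁻¹ * x)⁻¹ * g * (f⁻¹ * x) = x⁻¹ * (f * g * f⁻¹) * x := by group
    rw [e] at h
    exact h
  one_mem x := by
    have h := B.one_mem
    rw [← B.extGrade_coe] at h
    simpa using h
  mul_mem f g a b ha hb x := by
    have e : x⁻¹ * (f * g) * x = (x⁻¹ * f * x) * (x⁻¹ * g * x) := by group
    change a.1 x * b.1 x ∈ _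
    rw [e]
    have h1 := ha x
    have h2 := hb x
    by_cases hf : x⁻¹ * f * x ∈ H
    · by_cases hg : x⁻¹ * g * x ∈ H
      · have h3 := B.mul_mem ⟨_, hf⟩ ⟨_, hg⟩ (a.1 x) (b.1 x)
          (by rw [← extGrade_coe]; exact h1) (by rw [← extGrade_coe]; exact h2)
        rw [← extGrade_coe] at h3
        exact h3
      · rw [B.extGrade_of_notMem hg, Submodule.mem_bot] at h2
        rw [h2, mul_zero]; exact Submodule.zero_mem _
    · rw [B.extGrade_of_notMem hf, Submodule.mem_bot] at h1
      rw [h1, zero_mul]; exact Submodule.zero_mem _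

end Transfer

end ZAlgebra

/-! Elements of degree `1` are central, so `A_e` is a finite-dimensional commutative algebra. For a
`G`-stable set `S` of elements of `A_e`, the annihilator of `S` in `A` is an ideal in `Z(G)`, hence
`0` or `A` (`isIdeal_annihilator`). Taking for `S` the nilpotents shows that `A_e` is reduced, so
over an algebraically closed field a minimal idempotent `p` satisfies `p A_e = k p`. Taking for `S`
the orbit of `p`, whose distinct members are orthogonal, shows that the orbit sums to `1`. Thus
`A_e` is the algebra of functions on the orbit `G / H`.

The braiding yields the crucial vanishing: for `a` of degree `g`, `p a = p (p a) = p (a p) = p g(p)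
a`, which is `0` when `g ∉ H`. Hence `B = p A` is graded by `H` and is an algebra in `Z(H)` with
unit `p`. The blocks `g(p) A` are the translates of `B`, and recording all of them as `a ↦ (g ↦ p
(g⁻¹ a))` identifies `A` with the transfer of `B`. Separability restricts along the retraction `a ↦
p a`; an ideal of `B` is tested for triviality through the ideal of `A` that it induces.

`IsSplitting` isolates the properties of `p` used in the construction of `B` and of the isomorphism.
-/

namespace ZAlgebra

/-! ### Idempotents and nilpotents in commutative Artinian rings -/

section CommutativeRing

variable {k : Type u} [Field k] {R : Type w} [CommRing R] [Algebra k R] [Module.Finite k R]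

theorem IsMinimalIdempotent.mul_eq_zero {R : Type*} [CommRing R] {p q : R}
    (hp : IsMinimalIdempotent p) (hq : IsMinimalIdempotent q) (hne : p ≠ q) : p * q = 0 := by
  have hi : IsIdempotentElem (p * q) := hp.1.mul hq.1
  have hpp : p * p = p := hp.1
  have hqq : q * q = q := hq.1
  rcases hp.2.2 (p * q) hi (by rw [mul_right_comm, hpp]) (by rw [← mul_assoc, hpp]) with h | h
  · exact h
  rcases hq.2.2 (p * q) hi (by rw [mul_assoc, hqq])
    (by rw [mul_left_comm, hqq]) with h' | h'
  · exact h'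
  · exact absurd (h.symm.trans h') hne

theorem exists_isMinimalIdempotent {R : Type*} [CommRing R] [IsArtinianRing R] [Nontrivial R] :
    ∃ p : R, IsMinimalIdempotent p := by
  obtain ⟨I, ⟨p, hpi, hp0, rfl⟩, hmin⟩ := WellFounded.has_min
    (wellFounded_lt (α := Ideal R))
    {I | ∃ p : R, IsIdempotentElem p ∧ p ≠ 0 ∧ I = Ideal.span {p}}
    ⟨_, 1, IsIdempotentElem.one, one_ne_zero, rfl⟩
  refine ⟨p, hpi, hp0, fun q hq hqp _ => or_iff_not_imp_left.2 fun hq0 => ?_⟩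
  have hle : Ideal.span {q} ≤ Ideal.span {p} :=
    Ideal.span_singleton_le_span_singleton.2 ⟨q, by rw [mul_comm, hqp]⟩
  have hge : Ideal.span {p} ≤ Ideal.span {q} := by
    by_contra h
    exact hmin _ ⟨q, hq, hq0, rfl⟩ (lt_of_le_not_ge hle h)
  obtain ⟨r, rfl⟩ := Ideal.span_singleton_le_span_singleton.1 hge
  rw [← mul_assoc, hq.eq] at hqp
  exact hqp.symm

/-- Multiplication by `a` on `p R` has an eigenvalue `c`, so `b = p a - c p` kills a nonzero `v` in
`p R`. Some power of `b` is divisible by all higher ones, which produces an idempotent below `p`. It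
cannot be `p` because it kills `v`, so it is `0`; then `b` is nilpotent, hence `0`. -/
theorem IsMinimalIdempotent.exists_mul_eq_smul [IsAlgClosed k] [IsReduced R] {p : R}
    (hp : IsMinimalIdempotent p) (a : R) : ∃ c : k, p * a = c • p := by
  have : IsArtinianRing R := IsArtinianRing.of_finite k R
  have hpp : p * p = p := hp.1
  let V : Submodule k R := LinearMap.range (LinearMap.mulLeft k p)
  let T : Module.End k V := (LinearMap.mulLeft k a).restrict (p := V) (q := V) (by
    rintro _ ⟨x, rfl⟩
    exact ⟨a * x, by simp [mul_left_comm]⟩)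
  have : Nontrivial V := ⟨⟨⟨p, p, hpp⟩, 0, fun h => hp.2.1 (congrArg Subtype.val h)⟩⟩
  obtain ⟨c, hc⟩ := Module.End.exists_eigenvalue T
  obtain ⟨⟨v, x, hx⟩, hv⟩ := hc.exists_hasEigenvector
  have hv0 : v ≠ 0 := fun h => hv.2 (Subtype.ext h)
  have hav : a * v = c • v := congrArg Subtype.val hv.apply_eq_smul
  have hpv : p * v = v := by
    rw [← hx, LinearMap.mulLeft_apply, ← mul_assoc, hpp]
  refine ⟨c, ?_⟩
  set b : R := p * a - c • p with hb
  have hpb : p * b = b := by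
    rw [hb, mul_sub, ← mul_assoc, hpp, mul_smul_comm, hpp]
  have hbv : b * v = 0 := by
    rw [hb, sub_mul, mul_assoc, hav, mul_smul_comm, smul_mul_assoc, sub_self]
  obtain ⟨n, y, hy⟩ := IsArtinian.exists_pow_succ_smul_dvd b (1 : R)
  simp only [smul_eq_mul, mul_one] at hy
  have hstep : ∀ m, ∃ z, b ^ n = b ^ (n + m) * z := by
    intro m
    induction m with
    | zero => exact ⟨1, by simp⟩
    | succ m ih =>
      obtain ⟨z, hz⟩ := ih
      refine ⟨y * z, ?_⟩
      calc b ^ n = b ^ m * b ^ n * z := by rw [mul_comm (b ^ m), ← pow_add]; exact hz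
        _ = b ^ m * (b ^ n.succ * y) * z := by rw [hy]
        _ = _ := by rw [Nat.succ_eq_add_one]; ring
  -- The exponent is `n + (n + 2) = 2 (n + 1)`: after multiplying by `b`, `b ^ (n + 1)` is a
  -- multiple of its own square, so `b ^ (n + 1) * (z * b)` is idempotent. Using `n + 1` keeps a
  -- factor `b` even when `n = 0`.
  obtain ⟨z, hz⟩ := hstep (n + 2)
  have hz' : b ^ (n + 1) = b ^ (n + 1) * (b ^ (n + 1) * (z * b)) := by
    calc b ^ (n + 1) = b ^ n * b := pow_succ _ _
      _ = b ^ (n + (n + 2)) * z * b := by rw [← hz]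
      _ = _ := by ring
  have hqi : IsIdempotentElem (b ^ (n + 1) * (z * b)) := by
    change _ * _ = _
    calc _ = b ^ (n + 1) * (b ^ (n + 1) * (z * b)) * (z * b) := by ring
      _ = _ := by rw [← hz']
  have hpq : p * (b ^ (n + 1) * (z * b)) = b ^ (n + 1) * (z * b) := by
    rw [pow_succ', ← mul_assoc, ← mul_assoc p, hpb]
  rcases hp.2.2 _ hqi (by rw [mul_comm, hpq]) hpq with h | h
  · rw [h, mul_zero] at hz'
    exact sub_eq_zero.1 (pow_eq_zero_iff (Nat.succ_ne_zero n) |>.1 hz')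
  · refine absurd ?_ hv0
    calc v = b ^ (n + 1) * (z * b) * v := by rw [h, hpv]
      _ = b ^ (n + 1) * z * (b * v) := by ring
      _ = 0 := by rw [hbv, mul_zero]

/-- A Noetherian ring that is not reduced has a nonzero element killed by all nilpotents. -/
theorem exists_ne_zero_mul_nilpotent_eq_zero {R : Type*} [CommRing R] [IsNoetherianRing R]
    [Nontrivial R] : ∃ x : R, x ≠ 0 ∧ ∀ n : R, IsNilpotent n → x * n = 0 := by
  classical
  have hex : ∃ m, nilradical R ^ m = ⊥ := IsNoetherianRing.isNilpotent_nilradical R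
  obtain ⟨m, hm⟩ : ∃ m, Nat.find hex = m + 1 := Nat.exists_eq_succ_of_ne_zero fun h => by
    have := Nat.find_spec hex
    rw [h, pow_zero, Ideal.one_eq_top] at this
    exact top_ne_bot this
  -- The last nonzero power of the nilradical is killed by the nilradical.
  have hne : nilradical R ^ m ≠ ⊥ := Nat.find_min hex (by omega)
  obtain ⟨x, hx, hx0⟩ := Submodule.exists_mem_ne_zero_of_ne_bot hne
  refine ⟨x, hx0, fun n hn => ?_⟩
  have hspec := Nat.find_spec hex
  rw [hm, pow_succ] at hspec
  have := Ideal.mul_mem_mul hx (mem_nilradical.2 hn)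
  rwa [hspec, Ideal.mem_bot] at this

end CommutativeRing
end ZAlgebra

namespace ZAlgebra

/-! ### Homogeneous subspaces -/

section Homogeneous

variable {k : Type u} [Field k] {G : Type v} [Group G] (A : ZAlgebra.{u, v, w} k G)

theorem exists_sum_of_mem_iSup {V ι : Type*} [AddCommGroup V] [Module k V] [Fintype ι]
    {S : ι → Submodule k V} {a : V} (ha : a ∈ ⨆ i, S i) :
    ∃ c : ι → V, (∀ i, c i ∈ S i) ∧ ∑ i, c i = a := by
  have ha' : a ∈ ⨆ i ∈ (Finset.univ : Finset ι), S i := by simpa using ha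
  obtain ⟨c, hc⟩ := (Submodule.mem_iSup_finset_iff_exists_sum S a).1 ha'
  exact ⟨fun g => c g, fun g => (c g).2, hc⟩

/-- The components of an element of a homogeneous subspace belong to it. -/
theorem mem_of_sum_mem [Fintype G] {J : Submodule k A} (hJ : J ≤ ⨆ g : G, J ⊓ A.grade g)
    (σ : Equiv.Perm G) {d : G → A} (hd : ∀ g, d g ∈ A.grade (σ g)) (h : ∑ g, d g ∈ J) (g : G) :
    d g ∈ J := by
  obtain ⟨c, hc, hsum⟩ := exists_sum_of_mem_iSup (hJ h)
  have h1 : ∑ g, d (σ.symm g) = ∑ g, c g := by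
    rw [hsum]
    exact Equiv.sum_comp σ.symm d
  have h2 := (iSupIndep_iff_finsetSum_eq_imp_eq _).1 A.grade_indep Finset.univ
    (fun g => d (σ.symm g)) c
    (fun g _ => ⟨by simpa using hd (σ.symm g), (hc g).2⟩) h1 (σ g) (Finset.mem_univ _)
  simp only [Equiv.symm_apply_apply] at h2
  rw [h2]
  exact (hc _).1

/-- Each `L i` permutes the degrees, so it sends the components of `a` to components of `L i a`.
With `σ` trivial this serves annihilators; with `σ` conjugation it serves ideals induced from `p A`.
-/
theorem homogeneous_iInf_comap [Finite G] {J : Submodule k A}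
    (hJ : J ≤ ⨆ g : G, J ⊓ A.grade g) {ι : Type*} (L : ι → A →ₗ[k] A) (σ : ι → Equiv.Perm G)
    (hL : ∀ i g, ∀ a ∈ A.grade g, L i a ∈ A.grade (σ i g)) :
    ⨅ i, J.comap (L i) ≤ ⨆ g : G, (⨅ i, J.comap (L i)) ⊓ A.grade g := by
  have := Fintype.ofFinite G
  intro a ha
  obtain ⟨c, hc, rfl⟩ := exists_sum_of_mem_iSup (S := A.grade) (a := a) (by
    rw [A.grade_iSup]; trivial)
  refine Submodule.sum_mem _ fun g _ => Submodule.mem_iSup_of_mem g ⟨?_, hc g⟩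
  simp only [SetLike.mem_coe, Submodule.mem_iInf, Submodule.mem_comap, map_sum] at ha ⊢
  exact fun i => A.mem_of_sum_mem hJ (σ i) (fun g => hL i g _ (hc g)) (ha i) g

theorem bot_homogeneous : (⊥ : Submodule k A) ≤ ⨆ g : G, ⊥ ⊓ A.grade g := bot_le

end Homogeneous

/-! ### The degree-one part and annihilator ideals -/

section UnitPart

variable {k : Type u} [Field k] {G : Type v} [Group G] {A : ZAlgebra.{u, v, w} k G}

theorem IsCommutative.mul_comm_of_mem_grade_one (hA : A.IsCommutative) {a : A}
    (ha : a ∈ A.grade 1) (b : A) : a * b = b * a := by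
  rw [hA 1 a b ha, one_smul]

/-- The degree `1` part of a commutative algebra is a commutative ring. -/
abbrev unitPartCommRing (hA : A.IsCommutative) : CommRing A.unitPart :=
  { (inferInstance : Ring A.unitPart) with
    mul_comm := fun a b => Subtype.ext (hA.mul_comm_of_mem_grade_one a.2 b) }

theorem smul_mem_grade_one (g : G) {a : A} (ha : a ∈ A.grade 1) : g • a ∈ A.grade 1 := by
  simpa using A.smul_mem g 1 a ha

instance : SMul G A.unitPart := ⟨fun g a => ⟨g • (a : A), smul_mem_grade_one g a.2⟩⟩

theorem coe_smul_unitPart (g : G) (a : A.unitPart) : ((g • a : A.unitPart) : A) = g • (a : A) := rfl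

instance : MulSemiringAction G A.unitPart where
  one_smul _ := Subtype.ext (one_smul _ _)
  mul_smul _ _ _ := Subtype.ext (mul_smul _ _ _)
  smul_zero _ := Subtype.ext (smul_zero _)
  smul_add _ _ _ := Subtype.ext (smul_add _ _ _)
  smul_one _ := Subtype.ext (smul_one _)
  smul_mul _ _ _ := Subtype.ext (smul_mul' _ _ _)

theorem IsMinimalIdempotent.smul {R : Type*} [Ring R] [MulSemiringAction G R] {p : R}
    (hp : IsMinimalIdempotent p) (g : G) : IsMinimalIdempotent (g • p) := by
  refine ⟨?_, fun h => hp.2.1 ?_, fun q hq hqp hpq => ?_⟩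
  · change g • p * g • p = g • p
    rw [← smul_mul', hp.1.eq]
  · rwa [smul_eq_zero_iff_eq] at h
  · have key : ∀ x : R, g⁻¹ • x = p ↔ x = g • p := fun x => inv_smul_eq_iff
    rw [← key, ← smul_eq_zero_iff_eq (g⁻¹)]
    refine hp.2.2 _ ?_ ?_ ?_
    · change g⁻¹ • q * g⁻¹ • q = g⁻¹ • q
      rw [← smul_mul', hq.eq]
    · conv_rhs => rw [← hqp]
      rw [smul_mul', inv_smul_smul]
    · conv_rhs => rw [← hpq]
      rw [smul_mul', inv_smul_smul]

theorem mul_mem_grade_of_mem_grade_one {a b : A} {g : G} (ha : a ∈ A.grade 1)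
    (hb : b ∈ A.grade g) : a * b ∈ A.grade g := by
  simpa using A.mul_mem 1 g a b ha hb

/-- The elements annihilated by a set of elements of degree `1`. -/
def annihilator (S : Set A.unitPart) : Submodule k A :=
  ⨅ n : S, (⊥ : Submodule k A).comap (LinearMap.mulLeft k (n : A))

theorem mem_annihilator {S : Set A.unitPart} {x : A} :
    x ∈ annihilator S ↔ ∀ n ∈ S, (n : A) * x = 0 := by
  simp [annihilator]

theorem IsCommutative.isIdeal_annihilator [Finite G] (hA : A.IsCommutative)
    {S : Set A.unitPart} (hS : ∀ (g : G), ∀ n ∈ S, g • n ∈ S) : A.IsIdeal (annihilator S) where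
  homogeneous := A.homogeneous_iInf_comap A.bot_homogeneous _ (fun _ => Equiv.refl G)
    fun n _ _ ha => mul_mem_grade_of_mem_grade_one n.1.2 ha
  smul_mem g a ha := by
    rw [mem_annihilator] at ha ⊢
    intro n hn
    have := congrArg (g • ·) (ha _ (hS g⁻¹ n hn))
    simpa [coe_smul_unitPart, smul_mul'] using this
  mul_mem_left a b hb := by
    rw [mem_annihilator] at hb ⊢
    intro n hn
    rw [← mul_assoc, hA.mul_comm_of_mem_grade_one n.2 a, mul_assoc, hb n hn, mul_zero]
  mul_mem_right a b ha := by
    rw [mem_annihilator] at ha ⊢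
    intro n hn
    rw [← mul_assoc, ha n hn, zero_mul]

instance : Module.Finite k A.unitPart :=
  inferInstanceAs (Module.Finite k (Subalgebra.toSubmodule A.unitPart))

/-- The annihilator of the nilpotents of `A_e` is nonzero, hence contains `1` by simplicity, so
every nilpotent vanishes. -/
theorem IsCommutative.isReduced_unitPart [Finite G] (hA : A.IsCommutative) (hs : A.IsSimple) :
    IsReduced A.unitPart := by
  have := hs.1
  let _ := unitPartCommRing hA
  have hart : IsArtinianRing A.unitPart := IsArtinianRing.of_finite k A.unitPart
  obtain ⟨x, hx0, hx⟩ := exists_ne_zero_mul_nilpotent_eq_zero (R := A.unitPart)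
  have hI := hA.isIdeal_annihilator (S := {n | IsNilpotent n}) fun g n hn => by
    obtain ⟨m, hm⟩ := hn
    exact ⟨m, by rw [← smul_pow', hm, smul_zero]⟩
  rcases hs.2 _ hI with h | h
  · refine absurd (Subtype.ext ?_) hx0
    rw [ZeroMemClass.coe_zero, ← Submodule.mem_bot k, ← h, mem_annihilator]
    intro n hn
    rw [hA.mul_comm_of_mem_grade_one n.2]
    exact congrArg Subtype.val (hx n hn)
  · refine ⟨fun n hn => Subtype.ext ?_⟩
    have h1 : (1 : A) ∈ annihilator {n : A.unitPart | IsNilpotent n} := by rw [h]; trivial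
    simpa using mem_annihilator.1 h1 n hn

end UnitPart

/-! ### Minimal idempotents and their orbits -/

section Splitting

variable {k : Type u} [Field k] {G : Type v} [Group G] (A : ZAlgebra.{u, v, w} k G)

/-- A central idempotent of degree `1` whose translates are pairwise orthogonal, sum to `1`, and
are indexed by the cosets of `H`. -/
structure IsSplitting (H : Subgroup G) (p : A) : Prop where
  mem : p ∈ A.grade 1
  idem : p * p = p
  comm : ∀ a, a * p = p * a
  smul_eq : ∀ h ∈ H, h • p = p
  mul_smul_eq_zero : ∀ g ∉ H, p * g • p = 0
  mul_eq_zero : ∀ g ∉ H, ∀ a ∈ A.grade g, p * a = 0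
  one_mem_span : (1 : A) ∈ Submodule.span k (Set.range fun g : G => g • p)

variable {A}

/-- Local-to-global principle: `a = 1 * a` is a combination of its blocks `(g • p) * a`. -/
theorem IsSplitting.mem_of_forall {H : Subgroup G} {p : A} (hp : A.IsSplitting H p)
    {W : Submodule k A} {a : A} (h : ∀ g : G, (g • p) * a ∈ W) : a ∈ W := by
  have key : Submodule.span k (Set.range fun g : G => g • p) ≤
      W.comap (LinearMap.mulRight k a) :=
    Submodule.span_le.2 (Set.range_subset_iff.2 h)
  simpa using key hp.one_mem_span

theorem exists_isMinimalIdempotent_unitPart (hA : A.IsCommutative) (hs : A.IsSimple) :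
    ∃ p : A.unitPart, IsMinimalIdempotent p := by
  have := hs.1
  let _ := unitPartCommRing hA
  have hart : IsArtinianRing A.unitPart := IsArtinianRing.of_finite k A.unitPart
  exact exists_isMinimalIdempotent

theorem mul_smul_eq_zero_of_ne (hA : A.IsCommutative) {p : A.unitPart}
    (hp : IsMinimalIdempotent p) {g : G} (hg : g • (p : A) ≠ p) : (p : A) * g • (p : A) = 0 := by
  let _ := unitPartCommRing hA
  exact congrArg Subtype.val (IsMinimalIdempotent.mul_eq_zero hp (hp.smul g)
    fun h => hg (congrArg Subtype.val h).symm)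

theorem isSplitting_stabilizer [Finite G] (hA : A.IsCommutative) (hs : A.IsSimple)
    {p : A.unitPart} (hp : IsMinimalIdempotent p) :
    A.IsSplitting (MulAction.stabilizer G (p : A)) (p : A) := by
  have hpp : (p : A) * p = p := congrArg Subtype.val hp.1
  have hz : ∀ g ∉ MulAction.stabilizer G (p : A), (p : A) * g • (p : A) = 0 :=
    fun g hg => mul_smul_eq_zero_of_ne hA hp hg
  refine ⟨p.2, hpp, fun a => (hA.mul_comm_of_mem_grade_one p.2 a).symm, fun _ h => h, hz,
    fun g hg a ha => ?_, ?_⟩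
  -- Centrality of `p` turns the inner `p * a` into `a * p`, and the braiding turns that into `(g •
  -- p) * a`.
  · calc (p : A) * a = p * (p * a) := by rw [← mul_assoc, hpp]
      _ = p * g • (p : A) * a := by
        rw [hA.mul_comm_of_mem_grade_one p.2 a, hA g a p ha, mul_assoc]
      _ = 0 := by rw [hz g hg, zero_mul]
  · have := Fintype.ofFinite (G ⧸ MulAction.stabilizer G (p : A))
    set s : A := ∑ c : G ⧸ MulAction.stabilizer G (p : A), c.out • (p : A) with hsum
    have hI := hA.isIdeal_annihilator (S := Set.range fun g : G => g • p) (by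
      rintro g _ ⟨x, rfl⟩
      exact ⟨g * x, mul_smul g x p⟩)
    have hbot : annihilator (Set.range fun g : G => g • p) = ⊥ := by
      refine (hs.2 _ hI).resolve_right fun h => hp.2.1 (Subtype.ext ?_)
      have h1 : (1 : A) ∈ annihilator (Set.range fun g : G => g • p) := by rw [h]; trivial
      simpa using mem_annihilator.1 h1 p ⟨1, one_smul G p⟩
    -- By orthogonality, multiplying `s` by a translate of `p` returns that translate, so `1 - s`
    -- lies in the zero annihilator.
    have h0 : 1 - s = 0 := by
      rw [← Submodule.mem_bot k, ← hbot, mem_annihilator]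
      rintro _ ⟨x, rfl⟩
      change x • (p : A) * _ = 0
      rw [mul_sub, mul_one, hsum, Finset.mul_sum, sub_eq_zero,
        Finset.sum_eq_single (x : G ⧸ MulAction.stabilizer G (p : A))]
      · obtain ⟨h, hh⟩ := QuotientGroup.mk_out_eq_mul (MulAction.stabilizer G (p : A)) x
        have hph : (h : G) • (p : A) = p := h.2
        rw [hh, mul_smul, hph, ← smul_mul', hpp]
      · intro c _ hc
        have : x⁻¹ * c.out ∉ MulAction.stabilizer G (p : A) := fun hm => hc (by
          rw [QuotientGroup.eq.2 hm, QuotientGroup.out_eq'])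
        rw [← smul_inv_smul x (c.out • (p : A)), ← smul_mul', ← mul_smul, hz _ this, smul_zero]
      · intro h; exact absurd (Finset.mem_univ _) h
    rw [sub_eq_zero.1 h0]
    exact Submodule.sum_mem _ fun c _ => Submodule.subset_span ⟨_, rfl⟩

end Splitting
end ZAlgebra

namespace ZAlgebra

/-! ### The corner `p A` and its transfer -/

section Corner

variable {k : Type u} [Field k] {G : Type v} [Group G] {A : ZAlgebra.{u, v, w} k G}
  {H : Subgroup G} {p : A}

variable (p) in
/-- The subspace `p A` of `A`, for an idempotent `p`. -/
def cornerSubmodule : Submodule k A where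
  carrier := {a | p * a = a}
  add_mem' {a b} ha hb := by
    change p * (a + b) = a + b
    rw [mul_add, show p * a = a from ha, show p * b = b from hb]
  zero_mem' := mul_zero p
  smul_mem' c a ha := by
    change p * c • a = c • a
    rw [mul_smul_comm, show p * a = a from ha]

theorem cornerSubmodule_mul (a : cornerSubmodule p) : p * (a : A) = a := a.2

theorem tmul_mem_tensorGrade (A : ZAlgebra.{u, v, w} k G) {x y : A} {g f : G}
    (hx : x ∈ A.grade g) (hy : y ∈ A.grade (g⁻¹ * f)) : x ⊗ₜ[k] y ∈ A.tensorGrade f :=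
  Submodule.mem_iSup_of_mem g ⟨(⟨x, hx⟩ : A.grade g) ⊗ₜ[k] (⟨y, hy⟩ : A.grade (g⁻¹ * f)), rfl⟩

/-- Separability passes to an algebra `B` in `Z(H)` that is a retract of `A` compatibly with the
gradings, the actions of `H` and the multiplication by elements of `B`. -/
theorem IsSeparable.of_retract (hA : A.IsSeparable) (B : ZAlgebra.{u, v, w'} k H)
    (ι : B →ₗ[k] A) (π : A →ₗ[k] B) (hι : ∀ h, ∀ b ∈ B.grade h, ι b ∈ A.grade h)
    (hιs : ∀ (h : H) (b : B), ι (h • b) = (h : G) • ι b)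
    (hπ : ∀ h : H, ∀ a ∈ A.grade h, π a ∈ B.grade h)
    (hπ0 : ∀ g ∉ H, ∀ a ∈ A.grade g, π a = 0)
    (hπs : ∀ (h : H) (a : A), π ((h : G) • a) = h • π a)
    (hπι : ∀ b, π (ι b) = b) (hε : ∀ b a, ι (b * π a) = ι b * a) : B.IsSeparable := by
  obtain ⟨ε, κ, ⟨hε1, hε2⟩, ⟨hκ1, hκ2⟩, hεκ⟩ := hA
  refine ⟨ε ∘ₗ ι, TensorProduct.map π π κ,
    ⟨fun h hh a ha => hε1 h (fun h1 => hh (Subtype.ext h1)) _ (hι h a ha), fun h a => by simp [hιs, hε2]⟩,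
    ⟨?_, fun h => ?_⟩, fun b => ?_⟩
  · have hle : A.tensorGrade 1 ≤
        (B.tensorGrade 1).comap (TensorProduct.map π π) := by
      refine iSup_le fun g => ?_
      rintro _ ⟨t, rfl⟩
      change TensorProduct.map π π _ ∈ B.tensorGrade 1
      induction t using TensorProduct.induction_on with
      | zero => simp
      | add x y hx hy => rw [map_add, map_add]; exact Submodule.add_mem _ hx hy
      | tmul x y =>
        simp only [TensorProduct.map_tmul, Submodule.subtype_apply]
        by_cases hg : g ∈ H
        · exact tmul_mem_tensorGrade _ (hπ ⟨g, hg⟩ _ x.2)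
            (hπ (⟨g, hg⟩⁻¹ * 1) _ y.2)
        · rw [hπ0 g hg _ x.2, TensorProduct.zero_tmul]
          exact Submodule.zero_mem _
    exact hle hκ1
  · have hcomp : B.act h ∘ₗ π = π ∘ₗ A.act h :=
      LinearMap.ext fun a => (hπs h a).symm
    conv_rhs => rw [← hκ2 h]
    rw [← LinearMap.comp_apply, ← LinearMap.comp_apply, ← TensorProduct.map_comp,
      ← TensorProduct.map_comp, hcomp]
  -- By `hε`, pairing `b` with `π x` in `B` equals pairing `ι b` with `x` in `A`, so the identity
  -- for `κ` in `A` projects to the one in `B`.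
  · have key : TensorProduct.lid k B (LinearMap.rTensor B
        ((ε ∘ₗ ι) ∘ₗ LinearMap.mulLeft k b) (TensorProduct.map π π κ)) =
        π (TensorProduct.lid k A (LinearMap.rTensor A
          (ε ∘ₗ LinearMap.mulLeft k (ι b)) κ)) := by
      clear hκ1 hκ2 hεκ
      induction κ using TensorProduct.induction_on with
      | zero => simp
      | add x y hx hy => simp only [map_add, hx, hy]
      | tmul x y =>
        simp only [TensorProduct.map_tmul, LinearMap.rTensor_tmul, LinearMap.comp_apply,
          LinearMap.mulLeft_apply, TensorProduct.lid_tmul, map_smul, hε]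
    rw [key, hεκ, hπι]

namespace IsSplitting

variable (hp : A.IsSplitting H p)
include hp

/-- The ring `p A`, with unit `p`. -/
abbrev cornerRing : Ring (cornerSubmodule p) :=
  { (inferInstance : AddCommGroup (cornerSubmodule p)) with
    mul := fun a b => ⟨a * b, by
      change p * (a * b : A) = a * b
      rw [← mul_assoc, cornerSubmodule_mul]⟩
    one := ⟨p, hp.idem⟩
    mul_assoc := fun a b c => Subtype.ext (mul_assoc (a : A) b c)
    one_mul := fun a => Subtype.ext a.2
    mul_one := fun a => Subtype.ext ((hp.comm a).trans a.2)
    left_distrib := fun a b c => Subtype.ext (mul_add (a : A) b c)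
    right_distrib := fun a b c => Subtype.ext (add_mul (a : A) b c)
    zero_mul := fun a => Subtype.ext (zero_mul (a : A))
    mul_zero := fun a => Subtype.ext (mul_zero (a : A)) }

/-- The algebra `p A`. -/
abbrev cornerAlgebra : letI := hp.cornerRing; Algebra k (cornerSubmodule p) :=
  letI := hp.cornerRing
  Algebra.ofModule (fun r a b => Subtype.ext (smul_mul_assoc r (a : A) b))
    (fun r a b => Subtype.ext (mul_smul_comm r (a : A) b))

/-- The action of `H` on `p A`. -/
abbrev cornerAction : letI := hp.cornerRing; MulSemiringAction H (cornerSubmodule p) :=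
  letI := hp.cornerRing
  { smul := fun h a => ⟨(h : G) • (a : A), by
      change p * (h : G) • (a : A) = (h : G) • (a : A)
      have e := congrArg ((h : G) • ·) (cornerSubmodule_mul a)
      simpa only [smul_mul', hp.smul_eq h h.2] using e⟩
    one_smul := fun a => Subtype.ext (one_smul G (a : A))
    mul_smul := fun g h a => Subtype.ext (mul_smul (g : G) (h : G) (a : A))
    smul_zero := fun h => Subtype.ext (smul_zero (h : G))
    smul_add := fun h a b => Subtype.ext (smul_add (h : G) (a : A) b)
    smul_one := fun h => Subtype.ext (hp.smul_eq h h.2)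
    smul_mul := fun h a b => Subtype.ext (smul_mul' (h : G) (a : A) b) }

/-- The projection of `A` onto `p A`. -/
def cornerProj : A →ₗ[k] cornerSubmodule p :=
  (LinearMap.mulLeft k p).codRestrict _ fun a => by
    change p * (p * a) = p * a
    rw [← mul_assoc, hp.idem]

theorem cornerProj_coe (a : cornerSubmodule p) : hp.cornerProj a = a := Subtype.ext a.2

/-- The algebra `p A` in `Z(H)`. -/
def corner [Finite G] : ZAlgebra.{u, v, w} k H where
  carrier := cornerSubmodule p
  ring := hp.cornerRing
  algebra := hp.cornerAlgebra
  finite := inferInstanceAs (Module.Finite k (cornerSubmodule p))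
  action := hp.cornerAction
  smulComm := letI := hp.cornerRing; letI := hp.cornerAction
    ⟨fun h c a => Subtype.ext (smul_comm (h : G) c (a : A))⟩
  grade h := (A.grade h).comap (cornerSubmodule p).subtype
  grade_indep := by
    have h1 : iSupIndep fun h : H => A.grade h := A.grade_indep.comp Subtype.val_injective
    intro h
    rw [Submodule.disjoint_def]
    intro a ha hb
    refine Subtype.ext (Submodule.disjoint_def.1 (h1 h) _ ha ?_)
    have hle : (⨆ g, ⨆ (_ : g ≠ h), (A.grade (g : G)).comap (cornerSubmodule p).subtype) ≤
        (⨆ g : H, ⨆ (_ : g ≠ h), A.grade (g : G)).comap (cornerSubmodule p).subtype :=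
      iSup₂_le fun g hg b hb => Submodule.mem_iSup_of_mem g (Submodule.mem_iSup_of_mem hg hb)
    exact hle hb
  grade_iSup := by
    have := Fintype.ofFinite G
    refine eq_top_iff.2 fun a _ => ?_
    have ha : (a : A) ∈ ⨆ g, A.grade g := by rw [A.grade_iSup]; trivial
    obtain ⟨c, hc, hsum⟩ := exists_sum_of_mem_iSup ha
    -- Since `a = p a`, the components may be multiplied by `p`; those of degree outside `H` then
    -- vanish.
    rw [← hp.cornerProj_coe a, ← hsum, map_sum]
    refine Submodule.sum_mem _ fun g _ => ?_
    by_cases hg : g ∈ H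
    · exact Submodule.mem_iSup_of_mem ⟨g, hg⟩ (mul_mem_grade_of_mem_grade_one hp.mem (hc g))
    · rw [show hp.cornerProj (c g) = 0 from Subtype.ext (hp.mul_eq_zero g hg _ (hc g))]
      exact Submodule.zero_mem _
  smul_mem h g a ha := A.smul_mem h g a ha
  one_mem := hp.mem
  mul_mem f g a b ha hb := A.mul_mem f g a b ha hb

variable [Finite G]

/-- The inclusion of `p A` in `A`. -/
def cornerIncl : hp.corner →ₗ[k] A := (cornerSubmodule p).subtype

/-- The projection of `A` onto `p A`, as an algebra in `Z(H)`. -/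
def proj : A →ₗ[k] hp.corner := hp.cornerProj

theorem cornerIncl_injective : Function.Injective hp.cornerIncl := Subtype.val_injective

theorem cornerIncl_mul (a b : hp.corner) :
    hp.cornerIncl (a * b) = hp.cornerIncl a * hp.cornerIncl b := rfl

theorem cornerIncl_one : hp.cornerIncl 1 = p := rfl

theorem cornerIncl_smul (h : H) (a : hp.corner) :
    hp.cornerIncl (h • a) = (h : G) • hp.cornerIncl a := rfl

theorem mul_cornerIncl (a : hp.corner) : p * hp.cornerIncl a = hp.cornerIncl a :=
  cornerSubmodule_mul a

theorem cornerIncl_proj (a : A) : hp.cornerIncl (hp.proj a) = p * a := rfl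

theorem proj_cornerIncl (a : hp.corner) : hp.proj (hp.cornerIncl a) = a := hp.cornerProj_coe a

theorem proj_mul (a b : A) : hp.proj (a * b) = hp.proj a * hp.proj b := by
  apply hp.cornerIncl_injective
  rw [cornerIncl_mul]
  simp only [cornerIncl_proj]
  rw [mul_assoc, ← mul_assoc a, hp.comm, mul_assoc, ← mul_assoc p p, hp.idem]

theorem proj_one : hp.proj 1 = 1 := by
  apply hp.cornerIncl_injective
  rw [cornerIncl_proj, cornerIncl_one, mul_one]

theorem proj_smul (h : H) (a : A) : hp.proj ((h : G) • a) = h • hp.proj a := by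
  apply hp.cornerIncl_injective
  rw [cornerIncl_smul, cornerIncl_proj, cornerIncl_proj, smul_mul', hp.smul_eq h h.2]

theorem proj_eq_zero {g : G} (hg : g ∉ H) {a : A} (ha : a ∈ A.grade g) : hp.proj a = 0 :=
  Subtype.ext (hp.mul_eq_zero g hg a ha)

theorem proj_mem_grade {h : H} {a : A} (ha : a ∈ A.grade h) : hp.proj a ∈ hp.corner.grade h :=
  mul_mem_grade_of_mem_grade_one hp.mem ha

theorem proj_smul_cornerIncl {g : G} (hg : g ∉ H) (a : hp.corner) :
    hp.proj (g • hp.cornerIncl a) = 0 := by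
  apply hp.cornerIncl_injective
  rw [cornerIncl_proj, ← hp.mul_cornerIncl a, smul_mul', ← mul_assoc, hp.mul_smul_eq_zero g hg,
    zero_mul, map_zero]

theorem corner_isCommutative (hA : A.IsCommutative) : hp.corner.IsCommutative := fun h a b ha =>
  hp.cornerIncl_injective (hA h (hp.cornerIncl a) (hp.cornerIncl b) ha)

theorem corner_isSeparable (hA : A.IsSeparable) : hp.corner.IsSeparable :=
  hA.of_retract hp.corner hp.cornerIncl hp.proj (fun _ _ hb => hb) hp.cornerIncl_smul
    (fun _ _ ha => hp.proj_mem_grade ha) (fun _ hg _ ha => hp.proj_eq_zero hg ha) hp.proj_smul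
    hp.proj_cornerIncl fun b a => by
      rw [cornerIncl_mul, cornerIncl_proj, ← mul_assoc, hp.comm, hp.mul_cornerIncl]

/-- An ideal `J` of `p A` induces the ideal `I` of those `a` with `p (g a) ∈ J` for all `g`. It
contains `J`, because `p g(p) = 0` outside `H`, and if it contains `1` then `J` contains the unit
`p`. -/
theorem corner_isSimple (hne : p ≠ 0) (hA : A.IsSimple) : hp.corner.IsSimple := by
  refine ⟨⟨1, 0, fun h => hne (congrArg hp.cornerIncl h)⟩, fun J hJ => ?_⟩
  let J' : Submodule k A := J.map hp.cornerIncl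
  have hmem : ∀ b : hp.corner, hp.cornerIncl b ∈ J' ↔ b ∈ J := fun b =>
    hp.cornerIncl_injective.mem_set_image
  have hJ' : J' ≤ ⨆ g : G, J' ⊓ A.grade g := by
    refine Submodule.map_le_iff_le_comap.2 (hJ.homogeneous.trans (iSup_le fun h b hb => ?_))
    exact Submodule.mem_iSup_of_mem (h : G) ⟨(hmem b).2 hb.1, hb.2⟩
  let I : Submodule k A := ⨅ g : G, J'.comap (LinearMap.mulLeft k p ∘ₗ A.act g)
  have hI : ∀ a, a ∈ I ↔ ∀ g : G, hp.proj (g • a) ∈ J := fun a => by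
    simp only [I, Submodule.mem_iInf, Submodule.mem_comap]
    exact forall_congr' fun g => hmem (hp.proj (g • a))
  have hideal : A.IsIdeal I := by
    refine ⟨A.homogeneous_iInf_comap hJ' _ (fun g => (MulAut.conj g).toEquiv)
      fun g f a ha => mul_mem_grade_of_mem_grade_one hp.mem (A.smul_mem g f a ha),
      fun g a ha => ?_, fun a b hb => ?_, fun a b ha => ?_⟩
    · rw [hI] at ha ⊢
      intro f
      rw [← mul_smul]
      exact ha _
    · rw [hI] at hb ⊢
      intro f
      rw [smul_mul', hp.proj_mul]
      exact hJ.mul_mem_left _ _ (hb f)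
    · rw [hI] at ha ⊢
      intro f
      rw [smul_mul', hp.proj_mul]
      exact hJ.mul_mem_right _ _ (ha f)
  rcases hA.2 I hideal with h | h
  · left
    rw [eq_bot_iff]
    intro b hb
    have : hp.cornerIncl b ∈ I := (hI _).2 fun g => by
      by_cases hg : g ∈ H
      · rw [hp.proj_smul ⟨g, hg⟩, hp.proj_cornerIncl]
        exact hJ.smul_mem _ _ hb
      · rw [hp.proj_smul_cornerIncl hg]
        exact Submodule.zero_mem _
    rw [h, Submodule.mem_bot] at this
    exact hp.cornerIncl_injective (this.trans (map_zero _).symm)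
  · right
    have h1 : (1 : A) ∈ I := by rw [h]; trivial
    have h2 := (hI 1).1 h1 1
    rw [one_smul, hp.proj_one] at h2
    refine eq_top_iff.2 fun b _ => ?_
    simpa using hJ.mul_mem_left b 1 h2

/-- The morphism from `A` to the transfer of `p A`. -/
def toTransfer : A →ₐ[k] transferSubalgebra hp.corner :=
  AlgHom.codRestrict
    (AlgHom.ofLinearMap (LinearMap.pi fun g => hp.proj ∘ₗ A.act g⁻¹)
      (funext fun g => (congrArg hp.proj (smul_one g⁻¹)).trans hp.proj_one)
      fun a b => funext fun g => (congrArg hp.proj (smul_mul' g⁻¹ a b)).trans (hp.proj_mul _ _))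
    _ fun a g h => by
      change hp.proj ((g * h : G)⁻¹ • a) = h⁻¹ • hp.proj (g⁻¹ • a)
      rw [mul_inv_rev, mul_smul, ← hp.proj_smul]
      rfl

theorem toTransfer_apply (a : A) (g : G) : (hp.toTransfer a).1 g = hp.proj (g⁻¹ • a) := rfl

theorem smul_cornerIncl_toTransfer (a : A) (g : G) :
    g • hp.cornerIncl ((hp.toTransfer a).1 g) = (g • p) * a := by
  rw [toTransfer_apply, cornerIncl_proj, smul_mul', smul_inv_smul]

theorem toTransfer_injective : Function.Injective hp.toTransfer := by
  rw [injective_iff_map_eq_zero]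
  intro a ha
  rw [← Submodule.mem_bot k]
  refine hp.mem_of_forall fun g => ?_
  rw [← hp.smul_cornerIncl_toTransfer, ha]
  change g • hp.cornerIncl 0 ∈ _
  simp

/-- The images of the translates of `p A` are the symbols `p_g ⊗ b`, which span the transfer; this
gives surjectivity. -/
theorem toTransfer_smul_cornerIncl (g : G) (b : hp.corner) :
    hp.toTransfer (g • hp.cornerIncl b) = hp.corner.spike g b := by
  refine Subtype.ext (funext fun x => ?_)
  rw [toTransfer_apply, ← mul_smul]
  by_cases hx : g⁻¹ * x ∈ H
  · obtain ⟨h, rfl⟩ : ∃ h : H, x = g * h := ⟨⟨_, hx⟩, by simp⟩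
    have e : (g * (h : G))⁻¹ * g = ((h⁻¹ : H) : G) := by simp
    rw [spike_apply_mul, e, hp.proj_smul, hp.proj_cornerIncl]
  · rw [spike_apply_of_notMem _ _ hx, hp.proj_smul_cornerIncl]
    exact fun hc => hx (by simpa using H.inv_mem hc)

theorem toTransfer_surjective : Function.Surjective hp.toTransfer := by
  intro t
  have := Fintype.ofFinite (G ⧸ H)
  refine ⟨∑ c : G ⧸ H, c.out • hp.cornerIncl (t.1 c.out), ?_⟩
  rw [map_sum, hp.corner.eq_sum_spike t]
  simp only [toTransfer_smul_cornerIncl, ← hp.corner.eq_sum_spike t]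

theorem toTransfer_mem_grade (f : G) (a : A) :
    hp.toTransfer a ∈ hp.corner.transferGrade f ↔ a ∈ A.grade f := by
  -- The degree of `a` is read off block by block: translating the value at `g` back by `g` gives
  -- `(g • p) * a`.
  refine ⟨fun h => hp.mem_of_forall fun g => ?_, fun ha g => ?_⟩
  · rw [← hp.smul_cornerIncl_toTransfer]
    have hg : hp.cornerIncl ((hp.toTransfer a).1 g) ∈ A.grade (g⁻¹ * f * g) := by
      have hg := h g
      by_cases hH : g⁻¹ * f * g ∈ H
      · rwa [show g⁻¹ * f * g = ((⟨_, hH⟩ : H) : G) from rfl, extGrade_coe] at hg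
      · rw [extGrade_of_notMem _ hH, Submodule.mem_bot] at hg
        rw [hg, map_zero]
        exact Submodule.zero_mem _
    have := A.smul_mem g _ _ hg
    rwa [show g * (g⁻¹ * f * g) * g⁻¹ = f by group] at this
  · have hg := A.smul_mem g⁻¹ f a ha
    rw [inv_inv] at hg
    rw [toTransfer_apply]
    by_cases hH : g⁻¹ * f * g ∈ H
    · rw [show g⁻¹ * f * g = ((⟨_, hH⟩ : H) : G) from rfl, extGrade_coe]
      exact hp.proj_mem_grade hg
    · rw [hp.proj_eq_zero hH hg]
      exact Submodule.zero_mem _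

/-- `A` is isomorphic to the transfer of `p A`. -/
noncomputable def isoTransfer : Iso A hp.corner.transfer where
  toAlgEquiv := AlgEquiv.ofBijective hp.toTransfer ⟨hp.toTransfer_injective,
    hp.toTransfer_surjective⟩
  map_smul f a := by
    refine Subtype.ext (funext fun g => ?_)
    change hp.proj (g⁻¹ • f • a) = hp.proj ((f⁻¹ * g)⁻¹ • a)
    rw [mul_inv_rev, inv_inv, mul_smul]
  map_grade f a := hp.toTransfer_mem_grade f a

end IsSplitting

end Corner

end ZAlgebra

namespace ZAlgebra

/-! ### Functions on the orbit and the main theorem -/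

section Main

variable {k : Type u} [Field k] [IsAlgClosed k] {G : Type v} [Group G] [Finite G]
  {A : ZAlgebra.{u, v, w} k G}

theorem exists_mul_eq_smul_of_isMinimalIdempotent (hA : A.IsCommutative) (hs : A.IsSimple)
    {p : A.unitPart} (hp : IsMinimalIdempotent p) (a : A.unitPart) : ∃ c : k, p * a = c • p := by
  have hred := hA.isReduced_unitPart hs
  let _ := unitPartCommRing hA
  exact IsMinimalIdempotent.exists_mul_eq_smul (R := A.unitPart) hp a

theorem corner_grade_one (hA : A.IsCommutative) (hs : A.IsSimple) {p : A.unitPart}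
    (hp : IsMinimalIdempotent p) {H : Subgroup G} (hsp : A.IsSplitting H (p : A)) :
    hsp.corner.grade 1 = Submodule.span k {(1 : hsp.corner)} := by
  refine le_antisymm (fun b hb => ?_) (Submodule.span_le.2 (Set.singleton_subset_iff.2
    hsp.corner.one_mem))
  obtain ⟨c, hc⟩ := exists_mul_eq_smul_of_isMinimalIdempotent hA hs hp ⟨hsp.cornerIncl b, hb⟩
  refine Submodule.mem_span_singleton.2 ⟨c, hsp.cornerIncl_injective ?_⟩
  rw [map_smul, hsp.cornerIncl_one, ← hsp.mul_cornerIncl b]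
  exact (congrArg Subtype.val hc).symm

/-- The degree `1` part is the algebra of functions on `G / H`, the value of `a` at `g H` being the
scalar by which `a` acts on `g • p`. -/
theorem exists_algEquiv_functions (hA : A.IsCommutative) (hs : A.IsSimple) {p : A.unitPart}
    (hp : IsMinimalIdempotent p) {H : Subgroup G} (hsp : A.IsSplitting H (p : A)) :
    ∃ φ : A.unitPart ≃ₐ[k] (G ⧸ H → k), ∀ (a : A.unitPart) (g : G),
      (g • p) * a = φ a (g : G ⧸ H) • (g • p) := by
  have hex : ∀ (a : A.unitPart) (x : G ⧸ H), ∃ c : k, (x.out • p) * a = c • (x.out • p) :=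
    fun a x => exists_mul_eq_smul_of_isMinimalIdempotent hA hs (hp.smul x.out) a
  choose f hf using hex
  -- Translates of `p` are nonzero, so the scalars are unique; every algebraic identity for `f`
  -- follows by comparing multiples of `x.out • p`.
  have huniq : ∀ (x : G ⧸ H) {c d : k}, c • (x.out • p) = d • (x.out • p) → c = d :=
    fun x c d h => smul_left_injective k (hp.smul x.out).2.1 h
  let F : A.unitPart →ₐ[k] (G ⧸ H → k) := AlgHom.ofLinearMap
    { toFun := f
      map_add' := fun a b => funext fun x => huniq x (by
        rw [← hf, mul_add, hf, hf, Pi.add_apply, add_smul])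
      map_smul' := fun c a => funext fun x => huniq x (by
        rw [← hf, mul_smul_comm, hf, RingHom.id_apply, Pi.smul_apply, smul_assoc]) }
    (funext fun x => huniq x (by
      change f 1 x • _ = _
      rw [← hf, mul_one, Pi.one_apply, one_smul]))
    (fun a b => funext fun x => huniq x (by
      change f (a * b) x • _ = (f a x * f b x) • _
      rw [← hf, ← mul_assoc, hf, smul_mul_assoc, hf, mul_smul]))
  have hF : ∀ (a : A.unitPart) (g : G), (g • p) * a = F a (g : G ⧸ H) • (g • p) := by
    intro a g
    have hg : g • p = (g : G ⧸ H).out • p := by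
      obtain ⟨h, hh⟩ := QuotientGroup.mk_out_eq_mul H g
      rw [hh, mul_smul]
      exact congrArg (g • ·) (Subtype.ext (hsp.smul_eq h h.2)).symm
    rw [hg]
    exact hf a g
  refine ⟨AlgEquiv.ofBijective F ⟨?_, ?_⟩, hF⟩
  · rw [injective_iff_map_eq_zero]
    intro a ha
    refine Subtype.ext ((Submodule.mem_bot k).1 (hsp.mem_of_forall fun g => ?_))
    have := congrArg Subtype.val (hF a g)
    rw [ha, Pi.zero_apply, zero_smul] at this
    exact this
  · intro t
    have := Fintype.ofFinite (G ⧸ H)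
    -- The translates of `p` play the role of the indicator functions of the cosets.
    refine ⟨∑ c : G ⧸ H, t c • (c.out • p), funext fun x => huniq x ?_⟩
    have hx := hF (∑ c : G ⧸ H, t c • (c.out • p)) x.out
    rw [QuotientGroup.out_eq'] at hx
    rw [← hx, Finset.mul_sum, Finset.sum_eq_single x]
    · rw [mul_smul_comm, ← smul_mul', hp.1.eq]
    · intro c _ hc
      have hm : x.out⁻¹ * c.out ∉ H := fun hm => hc (by
        rw [← QuotientGroup.out_eq' x, QuotientGroup.eq.2 hm, QuotientGroup.out_eq'])
      have h0 : p * (x.out⁻¹ * c.out) • p = 0 := Subtype.ext (hsp.mul_smul_eq_zero _ hm)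
      rw [mul_smul_comm, ← smul_inv_smul x.out (c.out • p), ← smul_mul', ← mul_smul, h0,
        smul_zero, smul_zero]
    · intro h; exact absurd (Finset.mem_univ _) h

end Main

end ZAlgebra

theorem mainTheorem8 {k : Type u} [Field k] [IsAlgClosed k] [CharZero k]
    {G : Type v} [Group G] [Finite G] (A : ZAlgebra.{u, v, w} k G)
    (hcomm : A.IsCommutative) (hsep : A.IsSeparable) (hsimple : A.IsSimple) :
    (∃ p : A.unitPart, ZAlgebra.IsMinimalIdempotent p) ∧
    ∀ p : A.unitPart, ZAlgebra.IsMinimalIdempotent p →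
      ∃ H : Subgroup G, H = MulAction.stabilizer G (p : A) ∧
        (∃ φ : A.unitPart ≃ₐ[k] (G ⧸ H → k),
          (∀ (g : G) (a b : A.unitPart), (b : A) = g • (a : A) →
            ∀ x : G ⧸ H, φ b x = φ a (g⁻¹ • x)) ∧
          φ p = Set.indicator {((1 : G) : G ⧸ H)} 1) ∧
        ∃ B : ZAlgebra.{u, v, w} k H,
          B.IsCommutative ∧ B.IsSeparable ∧ B.IsSimple ∧
          B.grade 1 = Submodule.span k {(1 : B)} ∧
          Nonempty (ZAlgebra.Iso A B.transfer) := by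
  refine ⟨ZAlgebra.exists_isMinimalIdempotent_unitPart hcomm hsimple, fun p hp => ?_⟩
  have hsp := ZAlgebra.isSplitting_stabilizer hcomm hsimple hp
  refine ⟨_, rfl, ?_, hsp.corner, hsp.corner_isCommutative hcomm, hsp.corner_isSeparable hsep,
    hsp.corner_isSimple (fun h => hp.2.1 (Subtype.ext h)) hsimple,
    ZAlgebra.corner_grade_one hcomm hsimple hp hsp, ⟨hsp.isoTransfer⟩⟩
  obtain ⟨φ, hφ⟩ := ZAlgebra.exists_algEquiv_functions hcomm hsimple hp hsp
  have huniq : ∀ (g : G) {c d : k}, c • (g • p) = d • (g • p) → c = d :=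
    fun g c d h => smul_left_injective k (hp.smul g).2.1 h
  refine ⟨φ, fun g a b hb x => ?_, funext fun x => ?_⟩
  · obtain rfl : b = g • a := Subtype.ext hb
    induction x using QuotientGroup.induction_on with | _ x
    refine huniq x ?_
    -- Applying `g` to the relation defining the value of `φ a` at `g⁻¹ x` gives the relation
    -- defining that of `φ (g • a)` at `x`.
    have h1 := congrArg (g • ·) (hφ a (g⁻¹ * x))
    simp only [smul_mul', mul_smul, smul_inv_smul] at h1
    rw [← hφ, h1]
    refine Subtype.ext ?_
    change g • (_ • (g⁻¹ • x • (p : A))) = _ • (x • (p : A))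
    rw [smul_comm, smul_inv_smul]
    rfl
  · induction x using QuotientGroup.induction_on with | _ x
    refine huniq x ?_
    rw [← hφ]
    -- The value of `φ p` at the coset of `x` is governed by `(x • p) * p`, which is `p` on the
    -- stabiliser and `0` off it.
    by_cases hx : x ∈ MulAction.stabilizer G (p : A)
    · have h1 : (x : G ⧸ MulAction.stabilizer G (p : A)) = ((1 : G) : _) :=
        (QuotientGroup.eq.2 (by simpa using hx)).symm
      have h2 : x • p = p := Subtype.ext hx
      rw [Set.indicator_of_mem (Set.mem_singleton_iff.2 h1), h2, hp.1.eq, Pi.one_apply, one_smul]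
    · have h1 : (x : G ⧸ MulAction.stabilizer G (p : A)) ∉
          ({((1 : G) : G ⧸ MulAction.stabilizer G (p : A))} : Set _) := fun h =>
        hx (by simpa using QuotientGroup.eq.1 (Set.mem_singleton_iff.1 h).symm)
      have h2 : p * x • p = 0 := Subtype.ext (hsp.mul_smul_eq_zero x hx)
      rw [Set.indicator_of_notMem h1, zero_smul]
      refine Subtype.ext ((hsp.comm _).trans ?_)
      exact congrArg Subtype.val h2
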